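/- All graphs are finite and simple, and all minima in (1)–(5) are taken over positive integers. Let $G$ be a graph and let $k$ be a positive integer. Then the following are equivalent: (1) $G$ has chordality $\mathsf{chor}(G)=k$, where $\mathsf{chor}(G)$ is the minimum $k$ such that $G$ is the intersection of $k$ chordal graphs on $V(G)$ (a graph is chordal if it has no induced cycle of length at least four). (2) The minimum size of a non-edge-separating family of tree-decompositions of $G$ is $k$. (3) $k$ is the minimum integer such that $G$ is the intersection graph of a family of convex subgraphs of the Cartesian product of $k$ trees. (4) $k$ is the minimum integer such that $G$ is the intersection graph of a family of convex subgraphs of a median graph of tree-dimension $k$. (5) $G$ has tree-median-dimension $\mathsf{tmd}(G)=k$. Moreover, $\mathsf{tmd}(G)=\mathsf{chor}(G)$. Definitions. For a function $\beta\colon X\to 2^{V(G)}$ and $v\in V(G)$, write $\beta^{-1}(v)=\{x\in X: v\in\beta(x)\}$. The intersection graph of a family $(S_v)_{v\in V}$ of nonempty sets has vertex set $V$, distinct $u,v$ being adjacent iff $S_u\cap S_v\neq\emptyset$; for a family of subgraphs, take their vertex sets. A tree-decomposition of $G$ is a pair $(T,\beta)$ with $T$ a tree and $\beta\colon V(T)\to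 2^{V(G)}$ such that every $\beta^{-1}(v)$ is nonempty and induces a connected subgraph of $T$, and the intersection graph $H$ of the family $(\beta^{-1}(v))_{v\in V(G)}$ is a chordal graph containing $G$ as a subgraph; it separates the non-edges of $H$. A family of tree-decompositions of $G$ is non-edge-separating if every non-edge of $G$ is separated by some member of the family. In a connected graph $M$ with distance $d$, let $I(u,v)=\{x: d(u,v)=d(u,x)+d(x,v)\}$. A set $S$ of vertices is convex if $I(u,v)\subseteq S$ for all $u,v\in S$, and a subgraph is convex if its vertex set is. A connected graph $M$ is a median graph if $|I(u,v)\cap I(u,w)\cap I(v,w)|=1$ for all distinct vertices $u,v,w$. The tree-dimension of a graph is the minimum integer $k\ge 0$ such that it embeds isometrically into the Cartesian product of $k$ trees (the product of no trees being a single vertex), and $\infty$ if there is no such $k$. A complete $k$-tree-median-decomposition of $G$ is a pair $(M,\gamma)$ with $M$ a median graph of tree-dimension $k$ and $\gamma\colon V(M)\to 2^{V(G)}$ such that every $\gamma^{-1}(v)$ is nonempty and convex in $M$, the intersection graph of $(\gamma^{-1}(v))_{v\in V(G)}$ contains $G$ as a subgraph, and every $\gamma(x)$ is a clique of $G$; $\mathsf{tmd}(G)$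 is the minimum $k$ for which one exists. -/

import Mathlib

namespace GraphChordality

universe u v

/-! ### Chordal graphs and chordality -/

/-- A graph is chordal if it has no hole, i.e. no induced cycle of length at least four. -/
def IsChordal {V : Type u} (G : SimpleGraph V) : Prop :=
  ∀ n : ℕ, 4 ≤ n → IsEmpty (SimpleGraph.cycleGraph n ↪g G)

/-- `G` is the intersection of `k` chordal graphs on its vertex set. -/
def IsInterOfChordal {V : Type u} (G : SimpleGraph V) (k : ℕ) : Prop :=
  ∃ H : Fin k → SimpleGraph V, (∀ i, IsChordal (H i)) ∧ G = ⨅ i, H i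

/-- The chordality of `G`: the minimum positive integer `k` such that `G` is the intersection
of `k` chordal graphs (and `⊤` if there is none). -/
noncomputable def chordality {V : Type u} (G : SimpleGraph V) : ℕ∞ :=
  sInf ((fun k : ℕ => (k : ℕ∞)) '' {k : ℕ | 0 < k ∧ IsInterOfChordal G k})

/-! ### Intersection graphs -/

/-- The intersection graph of a family of sets. -/
def intersectionGraph {ι : Type u} {X : Type v} (S : ι → Set X) : SimpleGraph ι where
  Adj i j := i ≠ j ∧ (S i ∩ S j).Nonempty
  symm := ⟨fun _ _ h => ⟨h.1.symm, by rw [Set.inter_comm]; exact h.2⟩⟩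
  loopless := ⟨fun _ h => h.1 rfl⟩

/-- For `β : X → 2^V` and `v ∈ V`, the set `β⁻¹(v)` of all `x` with `v ∈ β x`. -/
def support {V : Type u} {X : Type v} (β : X → Set V) (v : V) : Set X :=
  {x | v ∈ β x}

/-! ### Tree-decompositions -/

/-- `(T, β)` is a representation of the graph `H` on a tree `T`. -/
structure IsTreeRepresentation {V : Type u} (H : SimpleGraph V) {N : Type v}
    (T : SimpleGraph N) (β : N → Set V) : Prop where
  isTree : T.IsTree
  nonempty : ∀ v, (support β v).Nonempty
  connected : ∀ v, (T.induce (support β v)).Connected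
  eq_intersectionGraph : H = intersectionGraph (support β)

/-- A tree-decomposition of `G`: a representation, on a finite tree, of a chordal completion
of `G`. -/
structure TreeDecomposition {V : Type u} (G : SimpleGraph V) where
  Node : Type
  finite_node : Finite Node
  tree : SimpleGraph Node
  bag : Node → Set V
  completion : SimpleGraph V
  le_completion : G ≤ completion
  isChordal_completion : IsChordal completion
  isRepresentation : IsTreeRepresentation completion tree bag

/-- A tree-decomposition separates the pair `{a, b}` if `{a, b}` is a non-edge of its chordal
completion. -/
def TreeDecomposition.Separates {V : Type u} {G : SimpleGraph V} (D : TreeDecomposition G)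
    (a b : V) : Prop :=
  a ≠ b ∧ ¬ D.completion.Adj a b

/-- There is a non-edge-separating family of `k` tree-decompositions of `G`. -/
def HasNonEdgeSeparatingFamily {V : Type u} (G : SimpleGraph V) (k : ℕ) : Prop :=
  ∃ D : Fin k → TreeDecomposition G,
    ∀ a b : V, a ≠ b → ¬ G.Adj a b → ∃ i, (D i).Separates a b

/-! ### Median graphs, Cartesian products, convexity -/

/-- The interval `I(a, b)`: all vertices lying on a shortest path from `a` to `b`. -/
def interval {W : Type u} (M : SimpleGraph W) (a b : W) : Set W :=
  {x | M.Reachable a x ∧ M.Reachable x b ∧ M.dist a b = M.dist a x + M.dist x b}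

/-- Median graphs. -/
def IsMedianGraph {W : Type u} (M : SimpleGraph W) : Prop :=
  M.Connected ∧ ∀ a b c : W, a ≠ b → a ≠ c → b ≠ c →
    ∃ x, interval M a b ∩ interval M a c ∩ interval M b c = {x}

/-- A set of vertices is (geodesically) convex. -/
def IsConvexSet {W : Type u} (M : SimpleGraph W) (S : Set W) : Prop :=
  ∀ a ∈ S, ∀ b ∈ S, interval M a b ⊆ S

/-- A subgraph is convex if its vertex set is convex. -/
def IsConvexSubgraph {W : Type u} {M : SimpleGraph W} (A : M.Subgraph) : Prop :=
  IsConvexSet M A.verts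

/-- The Cartesian product of a family of graphs: two vertices are adjacent if they are adjacent
in one coordinate and equal in all the others. -/
def cartesianProduct {ι : Type u} {N : ι → Type v} (T : ∀ i, SimpleGraph (N i)) :
    SimpleGraph (∀ i, N i) where
  Adj x y := ∃ i, (T i).Adj (x i) (y i) ∧ ∀ j, j ≠ i → x j = y j
  symm := ⟨fun _ _ ⟨i, h, h'⟩ => ⟨i, h.symm, fun j hj => (h' j hj).symm⟩⟩
  loopless := ⟨fun _ ⟨i, h, _⟩ => (T i).loopless.irrefl _ h⟩

/-- Isometric embeddings; distances are infinite between different components. -/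
def IsIsometricEmbedding {W : Type u} {X : Type v} (M : SimpleGraph W) (P : SimpleGraph X)
    (φ : W → X) : Prop :=
  ∀ a b : W, M.edist a b = P.edist (φ a) (φ b)

/-- `M` embeds isometrically into the Cartesian product of `k` (finite) trees. -/
def EmbedsInTreeProduct {W : Type u} (M : SimpleGraph W) (k : ℕ) : Prop :=
  ∃ (N : Fin k → Type) (T : ∀ i, SimpleGraph (N i)) (φ : W → ∀ i, N i),
    (∀ i, Finite (N i)) ∧ (∀ i, (T i).IsTree) ∧
      IsIsometricEmbedding M (cartesianProduct T) φ

/-- The tree-dimension of a graph: the minimum `k` such that it embeds isometrically into the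
Cartesian product of `k` trees (and `⊤` if there is none). -/
noncomputable def treeDimension {W : Type u} (M : SimpleGraph W) : ℕ∞ :=
  sInf ((fun k : ℕ => (k : ℕ∞)) '' {k : ℕ | EmbedsInTreeProduct M k})

/-- `G` is the intersection graph of a family of (nonempty) convex subgraphs of `M`. -/
def IsInterGraphOfConvexSubgraphs {V : Type u} (G : SimpleGraph V) {W : Type v}
    (M : SimpleGraph W) : Prop :=
  ∃ F : V → M.Subgraph, (∀ a, (F a).verts.Nonempty) ∧ (∀ a, IsConvexSubgraph (F a)) ∧
    G = intersectionGraph fun a => (F a).verts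

/-- `G` is the intersection graph of a family of convex subgraphs of the Cartesian product of
`k` (finite) trees. -/
def IsInterGraphInTreeProduct {V : Type u} (G : SimpleGraph V) (k : ℕ) : Prop :=
  ∃ (N : Fin k → Type) (T : ∀ i, SimpleGraph (N i)),
    (∀ i, Finite (N i)) ∧ (∀ i, (T i).IsTree) ∧
      IsInterGraphOfConvexSubgraphs G (cartesianProduct T)

/-- The property `M_k`: `G` is the intersection graph of a family of convex subgraphs of a
(finite) median graph of tree-dimension `k`. -/
def IsInterGraphInMedianGraph {V : Type u} (G : SimpleGraph V) (k : ℕ) : Prop :=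
  ∃ (W : Type) (M : SimpleGraph W), Finite W ∧ IsMedianGraph M ∧ treeDimension M = k ∧
    IsInterGraphOfConvexSubgraphs G M

/-! ### Tree-median-decompositions -/

/-- `(M, γ)` is a representation of the graph `H` on a median graph `M` of tree-dimension `k`. -/
structure IsMedianRepresentation {V : Type u} (H : SimpleGraph V) (k : ℕ) {W : Type v}
    (M : SimpleGraph W) (γ : W → Set V) : Prop where
  isMedianGraph : IsMedianGraph M
  treeDimension_eq : treeDimension M = k
  nonempty : ∀ v, (support γ v).Nonempty
  convex : ∀ v, IsConvexSet M (support γ v)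
  eq_intersectionGraph : H = intersectionGraph (support γ)

/-- A `k`-tree-median-decomposition of `G`: a representation of a `k`-tree-median-completion,
i.e. of a supergraph of `G` on the same vertices that has the property `M_k`. -/
structure TreeMedianDecomposition {V : Type u} (G : SimpleGraph V) (k : ℕ) where
  Node : Type
  finite_node : Finite Node
  graph : SimpleGraph Node
  bag : Node → Set V
  completion : SimpleGraph V
  le_completion : G ≤ completion
  hasProperty_completion : IsInterGraphInMedianGraph completion k
  isRepresentation : IsMedianRepresentation completion k graph bag

/-- A tree-median-decomposition of `G` is complete if every bag is a clique of `G`. -/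
def TreeMedianDecomposition.IsComplete {V : Type u} {G : SimpleGraph V} {k : ℕ}
    (D : TreeMedianDecomposition G k) : Prop :=
  ∀ x, G.IsClique (D.bag x)

/-- The tree-median-dimension of `G`: the minimum positive integer `k` such that `G` has a
complete `k`-tree-median-decomposition (and `⊤` if there is none). -/
noncomputable def treeMedianDimension {V : Type u} (G : SimpleGraph V) : ℕ∞ :=
  sInf ((fun k : ℕ => (k : ℕ∞)) ''
    {k : ℕ | 0 < k ∧ ∃ D : TreeMedianDecomposition G k, D.IsComplete})

end GraphChordality

/-! For each fixed `k`, the property minimised in each of (2)–(5) is equivalent to `G` being an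
intersection of `k` chordal graphs, so the minima agree.

From chordal graphs to convex subgraphs: a finite chordal graph is the intersection graph of
subtrees of a tree (`IsChordal.exists_isTreeRepresentation`, by removing simplicial vertices). With
one tree per chordal graph, assign to each vertex of `G` the box of its `k` subtrees. Boxes are
convex in the product, and two of them meet iff they meet in every coordinate. The product is
median, and its tree-dimension is exactly `k` because the trees are chosen with at least two
vertices (`treeDimension_cartesianProduct`).

Conversely, embed a median graph isometrically into a product of `k` trees and project the convex
sets to each factor. The projections are subtrees, so each factor gives a chordal graph
(`isChordal_intersectionGraph`). Disjoint convex sets have disjoint projections in some factor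
(`exists_disjoint_projections`), so these chordal graphs intersect in `G`.

For (2), the chordal graphs are the completions; for (5), completeness forces the completion to be
`G`. -/

namespace GraphChordality

universe u v w

open SimpleGraph

/-! ### Geodesics, intervals and convex sets. -/

section Metric

variable {W : Type u} {M : SimpleGraph W}

lemma mem_interval_iff (hM : M.Connected) {a b x : W} :
    x ∈ interval M a b ↔ M.dist a b = M.dist a x + M.dist x b :=
  ⟨fun h => h.2.2, fun h => ⟨hM.preconnected _ _, hM.preconnected _ _, h⟩⟩

lemma exists_isPath_support_subset {S : Set W} (hS : (M.induce S).Connected) {a b : W}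
    (ha : a ∈ S) (hb : b ∈ S) : ∃ p : M.Walk a b, p.IsPath ∧ ∀ x ∈ p.support, x ∈ S := by
  obtain ⟨p, hp⟩ := hS.exists_isPath ⟨a, ha⟩ ⟨b, hb⟩
  let f : M.induce S →g M := (Embedding.induce S).toHom
  have hf : Function.Injective f := Subtype.val_injective
  refine ⟨p.map f, hp.map hf, fun x hx => ?_⟩
  have hx' : x ∈ p.support.map f := Walk.support_map f p ▸ hx
  obtain ⟨y, -, rfl⟩ := List.mem_map.1 hx'
  exact y.2

lemma induce_connected_of_exists_walk {S : Set W} (a : W) (ha : a ∈ S)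
    (h : ∀ b ∈ S, ∃ p : M.Walk a b, ∀ x ∈ p.support, x ∈ S) : (M.induce S).Connected := by
  rw [connected_iff_exists_forall_reachable]
  refine ⟨⟨a, ha⟩, fun ⟨b, hb⟩ => ?_⟩
  obtain ⟨p, hp⟩ := h b hb
  exact ⟨p.induce S hp⟩

lemma mem_interval_of_mem_support {a b x : W} {p : M.Walk a b} (hp : p.length = M.dist a b)
    (hx : x ∈ p.support) : x ∈ interval M a b := by
  classical
  have h1 := M.dist_le (p.takeUntil x hx)
  have h2 := M.dist_le (p.dropUntil x hx)
  have h3 := congrArg Walk.length (p.take_spec hx)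
  rw [Walk.length_append] at h3
  have h4 := (p.takeUntil x hx).reachable.dist_triangle_left b
  exact ⟨(p.takeUntil x hx).reachable, (p.dropUntil x hx).reachable, by omega⟩

/-- A nonempty convex set of a connected graph induces a connected subgraph. -/
lemma IsConvexSet.induce_connected (hM : M.Connected) {S : Set W} (hS : IsConvexSet M S)
    (hne : S.Nonempty) : (M.induce S).Connected := by
  obtain ⟨a, ha⟩ := hne
  refine induce_connected_of_exists_walk a ha fun b hb => ?_
  obtain ⟨p, hp⟩ := hM.exists_walk_length_eq_dist a b
  exact ⟨p, fun x hx => hS a ha b hb (mem_interval_of_mem_support hp hx)⟩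

end Metric

/-! ### Intervals, gates and medians in trees. -/

section Tree

variable {N : Type u} {T : SimpleGraph N}

lemma length_eq_dist_of_isTree (hT : T.IsTree) {a b : N} {p : T.Walk a b} (hp : p.IsPath) :
    p.length = T.dist a b := by
  obtain ⟨q, hq, hq'⟩ := hT.connected.exists_path_of_dist a b
  rw [(hT.existsUnique_path a b).unique hp hq, hq']

lemma mem_support_iff_mem_interval (hT : T.IsTree) {a b x : N} {p : T.Walk a b}
    (hp : p.IsPath) : x ∈ p.support ↔ x ∈ interval T a b := by
  refine ⟨mem_interval_of_mem_support (length_eq_dist_of_isTree hT hp), fun hx => ?_⟩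
  obtain ⟨q, hq⟩ := hT.connected.exists_walk_length_eq_dist a x
  obtain ⟨r, hr⟩ := hT.connected.exists_walk_length_eq_dist x b
  have h : (q.append r).IsPath := by
    apply Walk.isPath_of_length_eq_dist
    rw [Walk.length_append, hq, hr, hx.2.2]
  rw [(hT.existsUnique_path a b).unique hp h]
  simp

lemma isConvexSet_of_induce_connected (hT : T.IsTree) {S : Set N}
    (hS : (T.induce S).Connected) : IsConvexSet T S := by
  intro a ha b hb x hx
  obtain ⟨p, hp, hpS⟩ := exists_isPath_support_subset hS ha hb
  exact hpS x ((mem_support_iff_mem_interval hT hp).2 hx)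

lemma interval_induce_connected (hT : T.IsTree) (a b : N) :
    (T.induce (interval T a b)).Connected := by
  obtain ⟨p, hp, -⟩ := hT.connected.exists_path_of_dist a b
  have : interval T a b = {x | x ∈ p.support} :=
    Set.ext fun x => (mem_support_iff_mem_interval hT hp).symm
  rw [this]
  exact p.connected_induce_support

/-- Intervals of a tree are linearly ordered by the distance to one end. -/
lemma dist_eq_add_of_mem_interval (hT : T.IsTree) {r s x y : N} (hx : x ∈ interval T r s)
    (hy : y ∈ interval T r s) (h : T.dist r x ≤ T.dist r y) :
    T.dist r y = T.dist r x + T.dist x y := by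
  obtain ⟨p, hp⟩ := hT.connected.exists_walk_length_eq_dist r x
  obtain ⟨q, hq⟩ := hT.connected.exists_walk_length_eq_dist x s
  have hpq : (p.append q).IsPath := by
    apply Walk.isPath_of_length_eq_dist
    rw [Walk.length_append, hp, hq, hx.2.2]
  have hy' := (mem_support_iff_mem_interval hT hpq).2 hy
  rw [Walk.mem_support_append_iff] at hy'
  have hxs := hx.2.2
  have hys := hy.2.2
  have hc := T.dist_comm (u := x) (v := y)
  rcases hy' with h1 | h1
  · have := (mem_interval_of_mem_support hp h1).2.2
    omega
  · have := (mem_interval_of_mem_support hq h1).2.2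
    omega

/-- Connected vertex sets of a tree are gated. -/
lemma exists_gate (hT : T.IsTree) {S : Set N} (hS : (T.induce S).Connected) (c : N) :
    ∃ m ∈ S, ∀ s ∈ S, m ∈ interval T c s := by
  classical
  have hne : S.Nonempty := by
    obtain ⟨⟨a, ha⟩⟩ := hS.nonempty
    exact ⟨a, ha⟩
  obtain ⟨m, hm, hmin⟩ : ∃ m ∈ S, ∀ s ∈ S, T.dist c m ≤ T.dist c s := by
    have h := WellFounded.has_min (measure fun s => T.dist c s).wf S hne
    obtain ⟨m, hm, h⟩ := h
    exact ⟨m, hm, fun s hs => not_lt.1 (h s hs)⟩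
  refine ⟨m, hm, fun s hs => ?_⟩
  obtain ⟨q, hq, hqS⟩ := exists_isPath_support_subset hS hm hs
  obtain ⟨p, hp, hpl⟩ := hT.connected.exists_path_of_dist c m
  -- A vertex common to both pieces lies in `S` and on a geodesic from `c` to `m`, so minimality of
  -- `m` forces it to be `m`.
  have hpq : (p.append q).IsPath := by
    rw [Walk.isPath_def, Walk.support_append, List.nodup_append]
    refine ⟨hp.support_nodup, hq.support_nodup.tail, ?_⟩
    rintro x hx y hy rfl
    have h1 := (mem_interval_of_mem_support hpl hx).2.2
    have h2 := hmin x (hqS x (List.mem_of_mem_tail hy))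
    have h3 : T.dist x m = 0 := by omega
    obtain rfl := hT.connected.dist_eq_zero_iff.1 h3
    have h4 := hq.support_nodup
    rw [← Walk.cons_tail_support, List.nodup_cons] at h4
    exact h4.1 hy
  rw [← mem_support_iff_mem_interval hT hpq]
  simp

/-- The median is the gate of `c` in the interval from `a` to `b`. -/
lemma exists_median (hT : T.IsTree) (a b c : N) :
    ∃ x, x ∈ interval T a b ∧ x ∈ interval T a c ∧ x ∈ interval T b c := by
  have hc := hT.connected
  obtain ⟨m, hm, h⟩ := exists_gate hT (interval_induce_connected hT a b) c
  have ha := h a (by simp [mem_interval_iff hc])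
  have hb := h b (by simp [mem_interval_iff hc])
  rw [mem_interval_iff hc] at ha hb
  have h1 := T.dist_comm (u := a) (v := c)
  have h2 := T.dist_comm (u := a) (v := m)
  have h3 := T.dist_comm (u := b) (v := c)
  have h4 := T.dist_comm (u := b) (v := m)
  have h5 := T.dist_comm (u := m) (v := c)
  refine ⟨m, hm, ?_, ?_⟩ <;> rw [mem_interval_iff hc] <;> omega

/-- The three interval equations determine the distance from `a` to a median, and a point of the
interval from `a` to `b` is determined by that distance. -/
lemma median_unique (hT : T.IsTree) {a b c x y : N}
    (hx : x ∈ interval T a b ∧ x ∈ interval T a c ∧ x ∈ interval T b c)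
    (hy : y ∈ interval T a b ∧ y ∈ interval T a c ∧ y ∈ interval T b c) : x = y := by
  obtain ⟨hx1, hx2, hx3⟩ := hx
  obtain ⟨hy1, hy2, hy3⟩ := hy
  have c1 := T.dist_comm (u := x) (v := b)
  have c2 := T.dist_comm (u := y) (v := b)
  have e1 := hx1.2.2
  have e2 := hx2.2.2
  have e3 := hx3.2.2
  have f1 := hy1.2.2
  have f2 := hy2.2.2
  have f3 := hy3.2.2
  have := dist_eq_add_of_mem_interval hT hx1 hy1 (by omega)
  exact hT.connected.dist_eq_zero_iff.1 (by omega)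

end Tree

/-! ### Distances, intervals and medians in products. -/

section Product

variable {ι : Type u} [Fintype ι] {N : ι → Type v} {T : ∀ i, SimpleGraph (N i)}

lemma sum_dist_le_length (hT : ∀ i, (T i).Connected) {x y : ∀ i, N i}
    (p : (cartesianProduct T).Walk x y) : ∑ i, (T i).dist (x i) (y i) ≤ p.length := by
  classical
  induction p with
  | nil => simp
  | @cons x z y h p ih =>
    have h' := h
    obtain ⟨i, hi, hne⟩ := h'
    have h1 : ∑ j, (T j).dist (x j) (y j) ≤
        ∑ j, ((if j = i then 1 else 0) + (T j).dist (z j) (y j)) := by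
      refine Finset.sum_le_sum fun j _ => ?_
      split_ifs with hj
      · subst hj
        have := (hT j).dist_triangle (u := x j) (v := z j) (w := y j)
        rwa [dist_eq_one_iff_adj.2 hi] at this
      · rw [hne j hj, zero_add]
    rw [Finset.sum_add_distrib] at h1
    simp only [Finset.sum_ite_eq', Finset.mem_univ, if_true] at h1
    rw [Walk.length_cons]
    omega

lemma exists_walk_length_eq_sum_dist (hT : ∀ i, (T i).Connected) (x y : ∀ i, N i) :
    ∃ p : (cartesianProduct T).Walk x y, p.length = ∑ i, (T i).dist (x i) (y i) := by
  classical
  induction hn : ∑ i, (T i).dist (x i) (y i) generalizing x with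
  | zero =>
    have : x = y := by
      funext i
      have := (Finset.sum_eq_zero_iff.1 hn) i (Finset.mem_univ i)
      exact (hT i).dist_eq_zero_iff.1 this
    subst this
    exact ⟨Walk.nil, rfl⟩
  | succ n ih =>
    obtain ⟨i, -, hi⟩ : ∃ i ∈ Finset.univ, (T i).dist (x i) (y i) ≠ 0 :=
      Finset.exists_ne_zero_of_sum_ne_zero (by omega)
    obtain ⟨q, hq⟩ := (hT i).exists_walk_length_eq_dist (x i) (y i)
    have hne : x i ≠ y i := fun h => hi (by rw [h, dist_self])
    obtain ⟨z, hadj, r, rfl⟩ := q.exists_eq_cons_of_ne hne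
    rw [Walk.length_cons] at hq
    have hr := (T i).dist_le r
    have htri := (hT i).dist_triangle (u := x i) (v := z) (w := y i)
    rw [dist_eq_one_iff_adj.2 hadj] at htri
    have hsum : ∑ j, (T j).dist (Function.update x i z j) (y j) = n := by
      rw [← Finset.add_sum_erase _ _ (Finset.mem_univ i)] at hn ⊢
      rw [Finset.sum_congr rfl (g := fun j => (T j).dist (x j) (y j))]
      · rw [Function.update_self]
        omega
      · intro j hj
        rw [Function.update_of_ne (Finset.ne_of_mem_erase hj)]
    obtain ⟨p, hp⟩ := ih _ hsum
    have hadj' : (cartesianProduct T).Adj x (Function.update x i z) :=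
      ⟨i, by rwa [Function.update_self], fun j hj => by rw [Function.update_of_ne hj]⟩
    exact ⟨Walk.cons hadj' p, by rw [Walk.length_cons, hp]⟩

lemma cartesianProduct_connected (hT : ∀ i, (T i).Connected) :
    (cartesianProduct T).Connected := by
  have : Nonempty (∀ i, N i) := ⟨fun i => (hT i).nonempty.some⟩
  exact ⟨fun x y => (exists_walk_length_eq_sum_dist hT x y).choose.reachable⟩

lemma cartesianProduct_dist (hT : ∀ i, (T i).Connected) (x y : ∀ i, N i) :
    (cartesianProduct T).dist x y = ∑ i, (T i).dist (x i) (y i) := by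
  refine le_antisymm ?_ ?_
  · obtain ⟨p, hp⟩ := exists_walk_length_eq_sum_dist hT x y
    exact hp ▸ dist_le p
  · obtain ⟨p, hp⟩ := (cartesianProduct_connected hT).exists_walk_length_eq_dist x y
    exact hp ▸ sum_dist_le_length hT p

/-- Distances add over coordinates, and a sum of triangle inequalities is an equality iff each of
them is. -/
lemma mem_interval_cartesianProduct (hT : ∀ i, (T i).Connected) {x y z : ∀ i, N i} :
    z ∈ interval (cartesianProduct T) x y ↔ ∀ i, z i ∈ interval (T i) (x i) (y i) := by
  simp only [mem_interval_iff (cartesianProduct_connected hT), mem_interval_iff (hT _),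
    cartesianProduct_dist hT, ← Finset.sum_add_distrib]
  rw [Finset.sum_eq_sum_iff_of_le fun i _ => (hT i).dist_triangle]
  simp

lemma isConvexSet_box (hT : ∀ i, (T i).Connected) {S : ∀ i, Set (N i)}
    (hS : ∀ i, IsConvexSet (T i) (S i)) :
    IsConvexSet (cartesianProduct T) {x | ∀ i, x i ∈ S i} := fun x hx y hy _ hz i =>
  hS i (x i) (hx i) (y i) (hy i) ((mem_interval_cartesianProduct hT).1 hz i)

lemma isMedianGraph_cartesianProduct (hT : ∀ i, (T i).IsTree) :
    IsMedianGraph (cartesianProduct T) := by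
  have hc := fun i => (hT i).connected
  refine ⟨cartesianProduct_connected hc, fun a b c _ _ _ => ?_⟩
  choose m hm using fun i => exists_median (hT i) (a i) (b i) (c i)
  refine ⟨m, Set.ext fun x => ?_⟩
  simp only [Set.mem_inter_iff, mem_interval_cartesianProduct hc, Set.mem_singleton_iff]
  constructor
  · rintro ⟨⟨h1, h2⟩, h3⟩
    exact funext fun i => median_unique (hT i) ⟨h1 i, h2 i, h3 i⟩ (hm i)
  · rintro rfl
    exact ⟨⟨fun i => (hm i).1, fun i => (hm i).2.1⟩, fun i => (hm i).2.2⟩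

end Product

/-! ### The tree-dimension of a product of trees. -/

section TreeDimension

lemma eq_of_common_neighbors {N : Type v} {T : SimpleGraph N} (hT : T.IsTree) {p q x y : N}
    (hpq : p ≠ q) (hpx : T.Adj p x) (hxq : T.Adj x q) (hpy : T.Adj p y) (hyq : T.Adj y q) :
    x = y := by
  have hc := hT.connected
  -- Adjacent vertices of a tree are never equidistant from a third, so there is no triangle.
  have h1 : ¬ T.Adj p q := fun h => hT.dist_ne_of_adj x h
    ((dist_eq_one_iff_adj.2 hpx.symm).trans (dist_eq_one_iff_adj.2 hxq).symm)
  have h2 := hc.one_lt_dist_of_ne_of_not_adj hpq h1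
  have e1 := dist_eq_one_iff_adj.2 hpx
  have e2 := dist_eq_one_iff_adj.2 hxq
  have e3 := dist_eq_one_iff_adj.2 hpy
  have e4 := dist_eq_one_iff_adj.2 hyq
  have h3 := hc.dist_triangle (u := p) (v := x) (w := q)
  have hx : x ∈ interval T p q := (mem_interval_iff hc).2 (by omega)
  have hy : y ∈ interval T p q := (mem_interval_iff hc).2 (by omega)
  have := dist_eq_add_of_mem_interval hT hx hy (by omega)
  exact hc.dist_eq_zero_iff.1 (by omega)

lemma IsIsometricEmbedding.injective {W : Type u} {X : Type v} {M : SimpleGraph W}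
    {P : SimpleGraph X} {φ : W → X} (h : IsIsometricEmbedding M P φ) :
    Function.Injective φ := fun a b hab => by
  rw [← edist_eq_zero_iff (G := M), h, hab, edist_self]

lemma IsIsometricEmbedding.adj_iff {W : Type u} {X : Type v} {M : SimpleGraph W}
    {P : SimpleGraph X} {φ : W → X} (h : IsIsometricEmbedding M P φ) {a b : W} :
    P.Adj (φ a) (φ b) ↔ M.Adj a b := by
  rw [← edist_eq_one_iff_adj, ← edist_eq_one_iff_adj, h]

/-- In a product of trees, a four-cycle is not contained in a single fibre. -/
lemma eq_of_square {ι : Type u} {N : ι → Type v} {T : ∀ i, SimpleGraph (N i)}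
    (hT : ∀ i, (T i).IsTree) {o p q z : ∀ i, N i} {t : ι} (hpq : p ≠ q)
    (hp : (T t).Adj (o t) (p t)) (hp' : ∀ j, j ≠ t → o j = p j)
    (hq : (T t).Adj (o t) (q t)) (hq' : ∀ j, j ≠ t → o j = q j)
    (hzp : (cartesianProduct T).Adj p z) (hzq : (cartesianProduct T).Adj z q) : z = o := by
  have hpq' : p t ≠ q t := fun h => hpq <| funext fun j => by
    by_cases hj : j = t
    · rw [hj, h]
    · rw [← hp' j hj, hq' j hj]
  obtain ⟨r, hr, hr'⟩ := hzp
  obtain ⟨s, hs, hs'⟩ := hzq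
  -- A change of `p` outside coordinate `t` would have to be undone by the second edge, leaving
  -- coordinate `t` unchanged.
  have hrt : r = t := by
    by_contra hne
    have hsr : s = r := by
      by_contra hsr
      have h1 := hs' r (Ne.symm hsr)
      rw [← hq' r hne, hp' r hne] at h1
      exact hr.ne h1.symm
    subst hsr
    exact hpq' ((hr' t (Ne.symm hne)).trans (hs' t (Ne.symm hne)))
  have hst : s = t := by
    by_contra hne
    have h1 := hr' s (hrt ▸ hne)
    rw [← hp' s hne, hq' s hne] at h1
    exact hs.ne h1.symm
  subst hrt hst
  funext j
  by_cases hj : j = s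
  · subst hj
    exact eq_of_common_neighbors (hT j) hpq' hr hs hp.symm hq
  · rw [← hr' j hj, hp' j hj]

/-- Choose at a base point one edge in each of the `k` directions. Any two of them span a square, so
by `eq_of_square` their images use different factors of the target. -/
lemma le_of_embedsInTreeProduct {k m : ℕ} {N : Fin k → Type} {T : ∀ i, SimpleGraph (N i)}
    (hT : ∀ i, (T i).IsTree) (hN : ∀ i, Nontrivial (N i))
    (h : EmbedsInTreeProduct (cartesianProduct T) m) : k ≤ m := by
  classical
  obtain ⟨N', T', φ, -, hT', hφ⟩ := h
  let o : ∀ i, N i := fun i => (hT i).connected.nonempty.some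
  choose b hb using fun i => (hT i).connected.preconnected.exists_adj_of_nontrivial (o i)
  have hadj : ∀ (x : ∀ i, N i) i, x i = o i →
      (cartesianProduct T).Adj x (Function.update x i (b i)) := fun x i hx =>
    ⟨i, by rw [Function.update_self, hx]; exact hb i,
      fun j hj => by rw [Function.update_of_ne hj]⟩
  choose c hc hc' using fun i => hφ.adj_iff.2 (hadj o i rfl)
  have hinj : Function.Injective c := by
    intro i j hij
    by_contra hne
    have h1 := hc j
    have h2 := hc' j
    rw [← hij] at h1 h2
    have h3 := hadj (Function.update o i (b i)) j (Function.update_of_ne (Ne.symm hne) _ _)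
    have h4 := hadj (Function.update o j (b j)) i (Function.update_of_ne hne _ _)
    rw [Function.update_comm (Ne.symm hne)] at h4
    have h5 := eq_of_square hT' (hφ.injective.ne fun he => ?_) (hc i) (hc' i) h1 h2
      (hφ.adj_iff.2 h3) (hφ.adj_iff.2 h4.symm)
    · have h6 := congrFun (hφ.injective h5) j
      rw [Function.update_self] at h6
      exact (hb j).ne h6.symm
    · have h6 := congrFun he i
      rw [Function.update_self, Function.update_of_ne hne] at h6
      exact (hb i).ne h6.symm
  simpa using Fintype.card_le_of_injective c hinj

lemma treeDimension_cartesianProduct {k : ℕ} {N : Fin k → Type} {T : ∀ i, SimpleGraph (N i)}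
    (hfin : ∀ i, Finite (N i)) (hT : ∀ i, (T i).IsTree) (hN : ∀ i, Nontrivial (N i)) :
    treeDimension (cartesianProduct T) = k := by
  refine le_antisymm (sInf_le ⟨k, ⟨N, T, id, hfin, hT, fun _ _ => rfl⟩, rfl⟩) (le_sInf ?_)
  rintro _ ⟨m, hm, rfl⟩
  exact Nat.cast_le.2 (le_of_embedsInTreeProduct hT hN hm)

lemma embedsInTreeProduct_of_treeDimension_eq {W : Type u} {M : SimpleGraph W} {k : ℕ}
    (h : treeDimension M = k) : EmbedsInTreeProduct M k := by
  have hne : ((fun k : ℕ => (k : ℕ∞)) '' {k : ℕ | EmbedsInTreeProduct M k}).Nonempty := by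
    rw [Set.nonempty_iff_ne_empty]
    intro he
    rw [treeDimension, he, sInf_empty] at h
    exact ENat.top_ne_natCast k h
  obtain ⟨m, hm, hmk⟩ := csInf_mem hne
  have : (m : ℕ∞) = k := hmk.trans h
  rwa [← Nat.cast_inj.1 this]

end TreeDimension

/-! ### Intersection graphs of subtrees are chordal. -/

open Fin.CommRing in
lemma cycleGraph_neighbors_ne_and_not_adj {m : ℕ} (i : Fin (m + 4)) :
    i + 1 ≠ i - 1 ∧ ¬ (cycleGraph (m + 4)).Adj (i + 1) (i - 1) := by
  have hmod : ∀ j < m + 4, j ≠ 0 → j % (m + 4) ≠ 0 := fun j hj hj' => by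
    rwa [Nat.mod_eq_of_lt hj]
  refine ⟨fun h => ?_, fun h => ?_⟩
  · have h' : (2 : Fin (m + 4)) = 0 := by linear_combination h
    exact hmod 2 (by omega) (by omega) (congrArg Fin.val h')
  · rcases (cycleGraph_adj (n := m + 2)).1 h with h | h
    · have h' : (1 : Fin (m + 4)) = 0 := by linear_combination h
      exact hmod 1 (by omega) (by omega) (congrArg Fin.val h')
    · have h' : (3 : Fin (m + 4)) = 0 := by linear_combination -h
      exact hmod 3 (by omega) (by omega) (congrArg Fin.val h')

/-- Root the tree. On a hole, take the subtree whose gate is farthest from the root: both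
neighbouring subtrees contain that gate, so they meet, although they are not adjacent on the hole.
-/
lemma isChordal_intersectionGraph {V : Type u} {N : Type v} {T : SimpleGraph N}
    (hT : T.IsTree) {S : V → Set N} (hS : ∀ a, (T.induce (S a)).Connected) :
    IsChordal (intersectionGraph S) := by
  intro n hn
  obtain ⟨m, rfl⟩ := Nat.exists_eq_add_of_le' hn
  refine ⟨fun f => ?_⟩
  let r : N := hT.connected.nonempty.some
  choose g hg hgr using fun a => exists_gate hT (hS a) r
  obtain ⟨i, hi⟩ := Finite.exists_max fun i => T.dist r (g (f i))
  have key : ∀ j, (cycleGraph (m + 4)).Adj i j → g (f i) ∈ S (f j) := by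
    intro j hij
    obtain ⟨-, x, hxi, hxj⟩ := f.map_adj_iff.2 hij
    have h1 := hgr _ x hxi
    have h2 := hgr _ x hxj
    have h3 := dist_eq_add_of_mem_interval hT h2 h1 (hi j)
    refine isConvexSet_of_induce_connected hT (hS (f j)) _ (hg (f j)) x hxj ?_
    have h4 := h1.2.2
    have h5 := h2.2.2
    exact (mem_interval_iff hT.connected).2 (by omega)
  have h1 : (cycleGraph (m + 4)).Adj i (i + 1) :=
    (cycleGraph_adj (n := m + 2)).2 (Or.inr (by simp))
  have h2 : (cycleGraph (m + 4)).Adj i (i - 1) :=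
    (cycleGraph_adj (n := m + 2)).2 (Or.inl (by simp))
  obtain ⟨hne, hnadj⟩ := cycleGraph_neighbors_ne_and_not_adj i
  exact hnadj (f.map_adj_iff.1 ⟨f.injective.ne hne, g (f i), key _ h1, key _ h2⟩)

/-! ### Projecting convex sets of a median graph to tree factors. -/

section Separation

variable {W : Type u} {M : SimpleGraph W}

lemma IsMedianGraph.exists_median (hM : IsMedianGraph M) (a b c : W) :
    ∃ x, x ∈ interval M a b ∧ x ∈ interval M a c ∧ x ∈ interval M b c := by
  simp only [mem_interval_iff hM.1]
  by_cases hab : a = b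
  · exact ⟨a, by simp [hab]⟩
  by_cases hac : a = c
  · exact ⟨a, by simp [hac]⟩
  by_cases hbc : b = c
  · exact ⟨b, by simp [hbc]⟩
  obtain ⟨x, hx⟩ := hM.2 a b c hab hac hbc
  have h : x ∈ interval M a b ∩ interval M a c ∩ interval M b c := hx ▸ rfl
  exact ⟨x, h.1.1.2.2, h.1.2.2.2, h.2.2.2⟩

variable {ι : Type v} {N : ι → Type w} {T : ∀ i, SimpleGraph (N i)}

lemma IsIsometricEmbedding.dist_eq_sum [Fintype ι] {φ : W → ∀ i, N i}
    (hφ : IsIsometricEmbedding M (cartesianProduct T) φ) (hT : ∀ i, (T i).Connected)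
    (a b : W) : M.dist a b = ∑ i, (T i).dist (φ a i) (φ b i) := by
  rw [← cartesianProduct_dist hT, SimpleGraph.dist, SimpleGraph.dist, hφ]

/-- Disjoint convex sets of a median graph embedded in a product of trees have disjoint
projections onto some factor. -/
lemma exists_disjoint_projections [Fintype ι] (hM : IsMedianGraph M) (hT : ∀ i, (T i).IsTree)
    {φ : W → ∀ i, N i} (hφ : IsIsometricEmbedding M (cartesianProduct T) φ) {A B : Set W}
    (hA : IsConvexSet M A) (hB : IsConvexSet M B) (hAne : A.Nonempty) (hBne : B.Nonempty)
    (hAB : ∀ x ∈ A, x ∉ B) : ∃ i, ∀ s ∈ A, ∀ t ∈ B, φ s i ≠ φ t i := by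
  classical
  have hTc := fun i => (hT i).connected
  obtain ⟨⟨x, y⟩, ⟨hx, hy⟩, hmin⟩ :
      ∃ p ∈ A ×ˢ B, ∀ q ∈ A ×ˢ B, M.dist p.1 p.2 ≤ M.dist q.1 q.2 := by
    obtain ⟨m, hm, h⟩ := WellFounded.has_min (measure fun q : W × W => M.dist q.1 q.2).wf
      (A ×ˢ B) (hAne.prod hBne)
    exact ⟨m, hm, fun s hs => not_lt.1 (h s hs)⟩
  have hmin' : ∀ s ∈ A, ∀ t ∈ B, M.dist x y ≤ M.dist s t := fun s hs t ht =>
    hmin (s, t) ⟨hs, ht⟩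
  have hxy : x ≠ y := fun h => hAB x hx (h ▸ hy)
  obtain ⟨p, hp⟩ := hM.1.exists_walk_length_eq_dist x y
  obtain ⟨x', hadj, p', rfl⟩ := p.exists_eq_cons_of_ne hxy
  rw [Walk.length_cons] at hp
  have hp' := M.dist_le p'
  have hx'A : x' ∉ A := fun h => by
    have := hmin' x' h y hy
    omega
  obtain ⟨i, hi, hi'⟩ := hφ.adj_iff.2 hadj
  -- Since `x` and `x'` differ only in coordinate `i`, that coordinate of `s` alone decides which of
  -- them is closer to `s`.
  have hshift : ∀ s, M.dist s x + (T i).dist (φ s i) (φ x' i) =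
      M.dist s x' + (T i).dist (φ s i) (φ x i) := by
    intro s
    rw [hφ.dist_eq_sum hTc, hφ.dist_eq_sum hTc,
      ← Finset.add_sum_erase _ _ (Finset.mem_univ i),
      ← Finset.add_sum_erase _ _ (Finset.mem_univ i),
      Finset.sum_congr rfl fun j hj => by rw [hi' j (Finset.ne_of_mem_erase hj)]]
    omega
  refine ⟨i, fun s hs t ht hst => ?_⟩
  have h1 := hshift s
  have h2 := hshift t
  have e := dist_eq_one_iff_adj.2 hadj
  have e' := M.dist_comm (u := x) (v := x')
  rw [← hst] at h2
  -- As `s` and `t` agree in coordinate `i`, they are closer to the same end of the edge. If it is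
  -- `x'`, then `x'` is on a geodesic from `s` to `x`, hence in `A`. If it is `x`, the median of
  -- `x`, `y`, `t` is `y` by minimality, so a geodesic from `x` to `t` passes through `y`; going
  -- through `x'` then shows that `t` is closer to `x'`.
  rcases (hT i).dist_eq_dist_add_one_of_adj (φ s i) hi with h | h
  · refine hx'A (hA s hs x hx ((mem_interval_iff hM.1).2 ?_))
    omega
  · obtain ⟨m, hm1, hm2, hm3⟩ := hM.exists_median x y t
    have h3 := hmin' x hx m (hB y hy t ht hm3)
    have h4 := hm1.2.2
    have hmy : m = y := hM.1.dist_eq_zero_iff.1 (by omega)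
    subst hmy
    have h5 := hm2.2.2
    have h6 := hM.1.dist_triangle (u := x') (v := m) (w := t)
    have c1 := M.dist_comm (u := t) (v := x)
    have c2 := M.dist_comm (u := t) (v := x')
    omega

/-- Steps of the walk in other directions are constant in coordinate `i` and are dropped. -/
lemma exists_walk_projection {φ : W → ∀ i, N i}
    (hφ : IsIsometricEmbedding M (cartesianProduct T) φ) (i : ι) {a b : W} (p : M.Walk a b) :
    ∃ q : (T i).Walk (φ a i) (φ b i), ∀ z ∈ q.support, ∃ x ∈ p.support, φ x i = z := by
  induction p with
  | nil => exact ⟨Walk.nil, by simp⟩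
  | @cons a c b h p ih =>
    obtain ⟨q, hq⟩ := ih
    have hq' : ∀ z ∈ q.support, ∃ x ∈ (Walk.cons h p).support, φ x i = z := fun z hz => by
      obtain ⟨x, hx, hxz⟩ := hq z hz
      exact ⟨x, by simp [hx], hxz⟩
    obtain ⟨j, hj, hj'⟩ := hφ.adj_iff.2 h
    by_cases hij : i = j
    · subst hij
      refine ⟨Walk.cons hj q, fun z hz => ?_⟩
      rw [Walk.support_cons, List.mem_cons] at hz
      rcases hz with rfl | hz
      · exact ⟨a, by simp, rfl⟩
      · exact hq' z hz
    · rw [hj' i hij]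
      exact ⟨q, hq'⟩

lemma projection_induce_connected {φ : W → ∀ i, N i}
    (hφ : IsIsometricEmbedding M (cartesianProduct T) φ) (i : ι) {A : Set W}
    (hA : (M.induce A).Connected) : ((T i).induce ((fun x => φ x i) '' A)).Connected := by
  obtain ⟨⟨a, ha⟩⟩ := hA.nonempty
  refine induce_connected_of_exists_walk (φ a i) ⟨a, ha, rfl⟩ ?_
  rintro _ ⟨b, hb, rfl⟩
  obtain ⟨p, -, hp⟩ := exists_isPath_support_subset hA ha hb
  obtain ⟨q, hq⟩ := exists_walk_projection hφ i p
  refine ⟨q, fun z hz => ?_⟩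
  obtain ⟨x, hx, rfl⟩ := hq z hz
  exact ⟨x, hp x hx, rfl⟩

end Separation

lemma isInterOfChordal_of_isMedianGraph {V : Type u} {G : SimpleGraph V} {W : Type v}
    {M : SimpleGraph W} {k : ℕ} (hM : IsMedianGraph M) (hk : EmbedsInTreeProduct M k)
    (hG : IsInterGraphOfConvexSubgraphs G M) : IsInterOfChordal G k := by
  obtain ⟨F, hne, hconv, rfl⟩ := hG
  obtain ⟨N, T, φ, -, hT, hφ⟩ := hk
  refine ⟨fun i => intersectionGraph fun a => (fun x => φ x i) '' (F a).verts, fun i =>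
    isChordal_intersectionGraph (hT i) fun a =>
      projection_induce_connected hφ i ((hconv a).induce_connected hM.1 (hne a)), ?_⟩
  ext a b
  rw [iInf_adj]
  constructor
  · rintro ⟨hab, x, hxa, hxb⟩
    exact ⟨fun i => ⟨hab, φ x i, ⟨x, hxa, rfl⟩, ⟨x, hxb, rfl⟩⟩, hab⟩
  · rintro ⟨h, hab⟩
    refine ⟨hab, ?_⟩
    by_contra hdisj
    obtain ⟨i, hi⟩ := exists_disjoint_projections hM hT hφ (hconv a) (hconv b) (hne a) (hne b)
      fun x hx hx' => hdisj ⟨x, hx, hx'⟩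
    obtain ⟨-, _, ⟨s, hs, rfl⟩, ⟨t, ht, hst⟩⟩ := h i
    exact hi s hs t ht hst.symm

/-! ### Holes built from shortest paths. -/

section Hole

lemma dist_getVert_getVert {W : Type u} {M : SimpleGraph W} {a b : W} {p : M.Walk a b}
    (hp : p.length = M.dist a b) {i j : ℕ} (hij : i ≤ j) (hj : j ≤ p.length) :
    M.dist (p.getVert i) (p.getVert j) = j - i := by
  have key : ∀ {x y : W} (q : M.Walk x y) (n m : ℕ), n ≤ m → m ≤ q.length →
      ∃ r : M.Walk (q.getVert n) (q.getVert m), r.length = m - n := fun q n m hnm hm =>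
    ⟨((q.drop n).take (m - n)).copy rfl (by rw [Walk.drop_getVert]; congr 1; omega),
      by simp; omega⟩
  obtain ⟨r, hr⟩ := key p i j hij hj
  obtain ⟨r1, hr1⟩ := key p 0 i (by omega) (by omega)
  obtain ⟨r2, hr2⟩ := key p j p.length hj le_rfl
  have h := M.dist_le r
  obtain ⟨s, hs⟩ := r.reachable.exists_walk_length_eq_dist
  have h' := M.dist_le (((r1.append s).append r2).copy p.getVert_zero p.getVert_length)
  simp only [Walk.length_copy, Walk.length_append] at h'
  omega

lemma cycleGraph_adj_iff_of_lt {n : ℕ} {i j : Fin n} (h : i < j) :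
    (cycleGraph n).Adj i j ↔ j.val = i.val + 1 ∨ (i.val = 0 ∧ j.val + 1 = n) := by
  rw [cycleGraph_adj', Fin.coe_sub_iff_le.2 h.le, Fin.coe_sub_iff_lt.2 h]
  have h1 : i.val < j.val := h
  have h2 := j.isLt
  omega

lemma nonempty_cycleGraph_embedding {V : Type u} {G : SimpleGraph V} {n : ℕ} (f : Fin n → V)
    (hne : ∀ i j, i < j → f i ≠ f j)
    (hadj : ∀ i j, i < j → (G.Adj (f i) (f j) ↔ (cycleGraph n).Adj i j)) :
    Nonempty (cycleGraph n ↪g G) := by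
  refine ⟨⟨⟨f, fun i j hij => ?_⟩, fun {i j} => ?_⟩⟩
  · rcases lt_trichotomy i j with h | h | h
    · exact (hne i j h hij).elim
    · exact h
    · exact (hne j i h hij.symm).elim
  · rcases lt_trichotomy i j with h | h | h
    · exact hadj i j h
    · subst h
      simp
    · rw [G.adj_comm, (cycleGraph n).adj_comm]
      exact hadj j i h

/-- Two neighbours of `w` that both attach to a connected set of non-neighbours of `w` are
adjacent. -/
lemma IsChordal.adj_of_attached {V : Type u} {G : SimpleGraph V} (hG : IsChordal G) {w x y : V}
    {C : Set V} (hC : (G.induce C).Connected) (hwC : w ∉ C) (hCw : ∀ c ∈ C, ¬ G.Adj w c)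
    (hx : G.Adj w x) (hy : G.Adj w y) (hxy : x ≠ y) (hxC : ∃ c ∈ C, G.Adj x c)
    (hyC : ∃ c ∈ C, G.Adj c y) : G.Adj x y := by
  by_contra hnadj
  obtain ⟨c, hc, hxc⟩ := hxC
  obtain ⟨d, hd, hdy⟩ := hyC
  let D : Set V := C ∪ {x, y}
  have hxD : x ∈ D := Or.inr (Or.inl rfl)
  have hyD : y ∈ D := Or.inr (Or.inr rfl)
  have hreach : (G.induce D).Reachable ⟨x, hxD⟩ ⟨y, hyD⟩ := by
    obtain ⟨q, -, hq⟩ := exists_isPath_support_subset hC hc hd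
    refine ⟨(Walk.cons hxc (q.concat hdy)).induce D fun z hz => ?_⟩
    simp only [Walk.support_cons, Walk.support_concat, List.mem_cons,
      List.mem_append, List.not_mem_nil, or_false] at hz
    rcases hz with rfl | hz | rfl
    · exact hxD
    · exact Or.inl (hq z hz)
    · exact hyD
  -- A geodesic of the subgraph induced on `D` is an induced path of `G`, of length at least two;
  -- `w` sees only its ends and closes it to a hole.
  obtain ⟨p, hp⟩ := hreach.exists_walk_length_eq_dist
  have h2 := hreach.one_lt_dist_of_ne_of_not_adj (fun h => hxy (congrArg Subtype.val h)) hnadj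
  have hdist := fun {i j : ℕ} => dist_getVert_getVert hp (i := i) (j := j)
  have hpw : ∀ i, (p.getVert i : V) ≠ w := by
    intro i h
    rcases (p.getVert i).2 with h' | h' | h'
    · exact hwC (h ▸ h')
    · exact hx.ne (h.symm.trans h')
    · exact hy.ne (h.symm.trans h')
  have hinj : ∀ i j, i < j → j ≤ p.length → p.getVert i ≠ p.getVert j := by
    intro i j hij hj h
    have := hdist hij.le hj
    rw [h, dist_self] at this
    omega
  have hpadj : ∀ i, i ≤ p.length →
      (G.Adj (p.getVert i) w ↔ i = 0 ∨ i = p.length) := by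
    intro i hi
    constructor
    · intro h
      by_contra! hcon
      rcases (p.getVert i).2 with h' | h' | h'
      · exact hCw _ h' h.symm
      · refine hinj 0 i (by omega) hi ?_
        rw [Walk.getVert_zero]
        exact Subtype.ext h'.symm
      · refine hinj i p.length (by omega) le_rfl ?_
        rw [Walk.getVert_length]
        exact Subtype.ext h'
    · rintro (rfl | rfl)
      · rw [Walk.getVert_zero]
        exact hx.symm
      · rw [Walk.getVert_length]
        exact hy.symm
  obtain ⟨f⟩ := nonempty_cycleGraph_embedding (G := G) (n := p.length + 2)
    (fun i => if i.val ≤ p.length then (p.getVert i.val : V) else w)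
    (fun i j hij => by
      have h1 : i.val < j.val := hij
      have h3 := j.isLt
      rw [if_pos (by omega)]
      split_ifs with hj
      · exact fun h => hinj i j h1 hj (Subtype.ext h)
      · exact hpw i)
    (fun i j hij => by
      have h1 : i.val < j.val := hij
      have h3 := j.isLt
      rw [cycleGraph_adj_iff_of_lt hij, if_pos (by omega)]
      split_ifs with hj
      · have h4 : G.Adj (p.getVert i : V) (p.getVert j) ↔
            (G.induce D).Adj (p.getVert i) (p.getVert j) := Iff.rfl
        rw [h4, ← dist_eq_one_iff_adj, hdist h1.le hj]
        omega
      · rw [hpadj i (by omega)]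
        omega)
  exact (hG _ (by omega)).false f

end Hole

/-! ### Simplicial vertices of chordal graphs. -/

section Simplicial

variable {V : Type u} {G : SimpleGraph V}

/-- A chordal graph has a simplicial vertex outside any given clique that is not everything. -/
lemma IsChordal.exists_simplicial (hG : IsChordal G) (S : Finset V) :
    ∀ K : Set V, G.IsClique K → K ⊆ S → (∃ s ∈ S, s ∉ K) →
      ∃ s ∈ S, s ∉ K ∧ G.IsClique {a | a ∈ S ∧ G.Adj s a} := by
  classical
  induction S using Finset.strongInduction with
  | H S ih =>
  intro K hK hKS hne
  -- With such a `w`, let `C` be the component of `c` among the non-neighbours of `w`, and `L` its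
  -- attachment set, a clique of neighbours of `w`. Induction on `C ∪ L` with the clique `L` gives a
  -- vertex of `C`; it has no further neighbours in `S`, and it avoids `K` because `w` dominates
  -- `K`.
  by_cases hw : ∃ w ∈ S, (∀ a ∈ K, a = w ∨ G.Adj w a) ∧ ∃ c ∈ S, c ≠ w ∧ ¬ G.Adj w c
  · obtain ⟨w, hwS, hwK, c, hcS, hcw, hwc⟩ := hw
    let R : Set V := {a | a ∈ S ∧ a ≠ w ∧ ¬ G.Adj w a}
    let C : Set V := {a | ∃ p : G.Walk c a, ∀ z ∈ p.support, z ∈ R}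
    let L : Set V := {a | a ∈ S ∧ a ∉ C ∧ ∃ b ∈ C, G.Adj a b}
    have hcC : c ∈ C := ⟨Walk.nil, by simp [R, hcS, hcw, hwc]⟩
    have hCR : ∀ a ∈ C, a ∈ R := fun a ⟨p, hp⟩ => hp a p.end_mem_support
    have hclosed : ∀ a ∈ C, ∀ b ∈ R, G.Adj a b → b ∈ C := by
      rintro a ⟨p, hp⟩ b hb hab
      refine ⟨p.concat hab, fun z hz => ?_⟩
      rw [Walk.support_concat, List.mem_append, List.mem_singleton] at hz
      rcases hz with hz | rfl
      · exact hp z hz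
      · exact hb
    have hCconn : (G.induce C).Connected := by
      refine induce_connected_of_exists_walk c hcC ?_
      rintro b ⟨p, hp⟩
      exact ⟨p, fun z hz => ⟨p.takeUntil z hz, fun z' hz' =>
        hp z' (p.support_takeUntil_subset_support hz hz')⟩⟩
    have hLw : ∀ a ∈ L, G.Adj w a := by
      rintro a ⟨haS, haC, b, hb, hab⟩
      by_contra hwa
      refine haC (hclosed b hb a ⟨haS, ?_, hwa⟩ hab.symm)
      rintro rfl
      exact (hCR b hb).2.2 hab
    have hL : G.IsClique L := by
      intro a ha b hb hab
      obtain ⟨b', hb', hbb'⟩ := hb.2.2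
      exact hG.adj_of_attached hCconn (fun h => (hCR w h).2.1 rfl)
        (fun z hz => (hCR z hz).2.2) (hLw a ha) (hLw b hb) hab ha.2.2 ⟨b', hb', hbb'.symm⟩
    let S' := S.filter fun a => a ∈ C ∨ a ∈ L
    have hS' : S' ⊂ S := by
      refine Finset.filter_ssubset.2 ⟨w, hwS, ?_⟩
      rintro (h | h)
      · exact (hCR w h).2.1 rfl
      · exact G.loopless.irrefl _ (hLw w h)
    obtain ⟨s, hsS', hsL, hs⟩ := ih S' hS' L hL
      (fun a ha => Finset.mem_coe.2 (Finset.mem_filter.2 ⟨ha.1, Or.inr ha⟩))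
      ⟨c, Finset.mem_filter.2 ⟨hcS, Or.inl hcC⟩, fun h => h.2.1 hcC⟩
    obtain ⟨hsS, hsC⟩ := Finset.mem_filter.1 hsS'
    replace hsC := hsC.resolve_right hsL
    refine ⟨s, hsS, fun hsK => ?_, hs.subset ?_⟩
    · rcases hwK s hsK with h | h
      · exact (hCR s hsC).2.1 h
      · exact (hCR s hsC).2.2 h
    · rintro a ⟨haS, hsa⟩
      refine ⟨Finset.mem_filter.2 ⟨haS, ?_⟩, hsa⟩
      by_cases haC : a ∈ C
      · exact Or.inl haC
      · exact Or.inr ⟨haS, haC, s, hsC, hsa.symm⟩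
  -- Vertices of the clique `K` dominate `K`, so they are adjacent to all other vertices of `S`.
  -- Hence every vertex of `S` dominates `K`, and `S` is a clique.
  · push Not at hw
    have hKu : ∀ a ∈ K, ∀ b ∈ S, b ≠ a → G.Adj a b := fun a ha =>
      hw a (hKS ha) fun b hb => or_iff_not_imp_left.2 fun hba => hK ha hb (Ne.symm hba)
    have hSu : ∀ a ∈ S, ∀ b ∈ S, b ≠ a → G.Adj a b := fun a ha =>
      hw a ha fun b hb => or_iff_not_imp_left.2 fun hba => (hKu b hb a ha (Ne.symm hba)).symm
    obtain ⟨s, hs, hsK⟩ := hne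
    exact ⟨s, hs, hsK, fun a ha b hb hab => hSu a ha.1 b hb.1 (Ne.symm hab)⟩

end Simplicial

/-! ### Attaching a leaf to a tree. -/

section AddLeaf

variable {N : Type u}

/-- The graph obtained from `T` by adding a new vertex adjacent to `t` only. -/
def addLeaf (T : SimpleGraph N) (t : N) : SimpleGraph (Option N) :=
  T.map Function.Embedding.some ⊔ edge none (some t)

lemma addLeaf_adj_none (T : SimpleGraph N) (t : N) : (addLeaf T t).Adj (some t) none :=
  Or.inr (by simp [edge_adj])

lemma induce_image_some_connected {T : SimpleGraph N} (t : N) {S : Set N}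
    (hS : (T.induce S).Connected) : ((addLeaf T t).induce (some '' S)).Connected := by
  obtain ⟨⟨a, ha⟩⟩ := hS.nonempty
  refine induce_connected_of_exists_walk (some a) ⟨a, ha, rfl⟩ ?_
  rintro _ ⟨b, hb, rfl⟩
  obtain ⟨p, -, hp⟩ := exists_isPath_support_subset hS ha hb
  let f : T →g addLeaf T t :=
    ⟨some, fun h => Or.inl ((SimpleGraph.map_adj_apply (f := Function.Embedding.some)).2 h)⟩
  refine ⟨p.map f, fun x hx => ?_⟩
  have hx' : x ∈ p.support.map f := Walk.support_map f p ▸ hx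
  obtain ⟨y, hy, rfl⟩ := List.mem_map.1 hx'
  exact ⟨y, hp y hy, rfl⟩

lemma induce_insert_none_connected {T : SimpleGraph N} {t : N} {S : Set N}
    (hS : (T.induce S).Connected) (ht : t ∈ S) :
    ((addLeaf T t).induce (some '' S ∪ {none})).Connected :=
  connected_induce_union (induce_image_some_connected t hS).preconnected
    Preconnected.of_subsingleton ⟨t, ht, rfl⟩ rfl (addLeaf_adj_none T t)

lemma addLeaf_isTree [Finite N] {T : SimpleGraph N} (hT : T.IsTree) (t : N) :
    (addLeaf T t).IsTree := by
  rw [isTree_iff_connected_and_card] at hT ⊢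
  refine ⟨?_, ?_⟩
  · have h := induce_insert_none_connected (t := t)
      ((induceUnivIso T).connected_iff.2 hT.1) (Set.mem_univ t)
    have huniv : (some '' Set.univ ∪ {none} : Set (Option N)) = Set.univ := by
      ext x
      cases x <;> simp
    rw [huniv] at h
    exact (induceUnivIso _).connected_iff.1 h
  · have h : (addLeaf T t).edgeSet =
        insert s(none, some t) (Function.Embedding.some.sym2Map '' T.edgeSet) := by
      rw [addLeaf, edgeSet_sup, edgeSet_map, edgeSet_edge_of_ne (by simp), Set.union_comm]
      rfl
    have hnot : s(none, some t) ∉ Function.Embedding.some.sym2Map '' T.edgeSet := by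
      rintro ⟨e, -, he⟩
      have : none ∈ Function.Embedding.some.sym2Map e := by rw [he]; simp
      simp [Function.Embedding.sym2Map] at this
    rw [h, Nat.card_coe_set_eq, Set.ncard_insert_of_notMem hnot,
      Set.ncard_image_of_injective _ (Function.Embedding.injective _), Finite.card_option,
      ← hT.2, Nat.card_coe_set_eq]

end AddLeaf

/-! ### Subtree representations of chordal graphs. -/

section Representation

variable {V : Type u} {G : SimpleGraph V}

/-- The part of a chordal graph inside a finite set has a representation on a finite tree whose
bags are exactly the sets cofinal in the cliques. -/
lemma IsChordal.exists_tree_bags (hG : IsChordal G) (S : Finset V) :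
    ∃ (N : Type) (T : SimpleGraph N) (β : N → Set V), Finite N ∧ Nontrivial N ∧ T.IsTree ∧
      (∀ a ∈ S, (T.induce (support β a)).Connected) ∧
      ∀ K : Set V, (K ⊆ S ∧ G.IsClique K) ↔ ∃ x, K ⊆ β x := by
  classical
  induction S using Finset.strongInduction with
  | H S ih =>
  rcases S.eq_empty_or_nonempty with rfl | ⟨s₀, hs₀⟩
  -- Two nodes rather than one, so that the tree is nontrivial, as the tree-dimension count
  -- requires.
  · refine ⟨Option Unit, addLeaf ⊥ (), fun _ => ∅, inferInstance, inferInstance,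
      addLeaf_isTree IsTree.of_subsingleton (), by simp, fun K => ?_⟩
    simp only [Finset.coe_empty, exists_const, and_iff_left_iff_imp]
    intro h
    rw [Set.subset_empty_iff.1 h]
    simp
  · obtain ⟨s, hs, -, hclique⟩ := hG.exists_simplicial S ∅ (by simp) (by simp) ⟨s₀, hs₀, by simp⟩
    obtain ⟨N, T, β, hfin, hnt, hT, hconn, hβ⟩ := ih (S.erase s) (Finset.erase_ssubset hs)
    let Q : Set V := {a | a ∈ S ∧ G.Adj s a}
    have hQ : Q ⊆ (S.erase s : Finset V) := fun a ha =>
      Finset.mem_coe.2 (Finset.mem_erase.2 ⟨ha.2.ne', ha.1⟩)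
    -- The neighbourhood `Q` of the simplicial vertex `s` lies in some bag; a leaf with bag `insert
    -- s Q` is hung there, which keeps the supports of vertices of `Q` connected.
    obtain ⟨t, ht⟩ := (hβ Q).1 ⟨hQ, hclique⟩
    have hβS : ∀ x, β x ⊆ (S.erase s : Finset V) := fun x => ((hβ (β x)).2 ⟨x, subset_rfl⟩).1
    let β' : Option N → Set V := fun o => o.elim (insert s Q) β
    have hsQ : s ∉ Q := fun h => h.2.ne rfl
    refine ⟨Option N, addLeaf T t, β', inferInstance, inferInstance, addLeaf_isTree hT t, ?_, ?_⟩
    · intro a ha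
      by_cases has : a = s
      · subst has
        have h : support β' a = {none} := by
          ext x
          cases x with
          | none => simp [support, β']
          | some x =>
            have : a ∉ β x := fun h => by simpa using hβS x h
            simpa [support, β'] using this
        rw [h]
        exact Connected.of_subsingleton
      · have hconn' := hconn a (Finset.mem_erase.2 ⟨has, ha⟩)
        by_cases haQ : a ∈ Q
        · have h : support β' a = some '' support β a ∪ {none} := by
            ext x
            cases x <;> simp [support, β', haQ]
          rw [h]
          exact induce_insert_none_connected hconn' (ht haQ)
        · have h : support β' a = some '' support β a := by
            ext x
            cases x <;> simp [support, β', haQ, has]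
          rw [h]
          exact induce_image_some_connected t hconn'
    · intro K
      constructor
      · rintro ⟨hKS, hK⟩
        by_cases hsK : s ∈ K
        · refine ⟨none, fun a ha => ?_⟩
          by_cases has : a = s
          · exact Or.inl has
          · exact Or.inr ⟨hKS ha, hK hsK ha (Ne.symm has)⟩
        · obtain ⟨x, hx⟩ := (hβ K).1 ⟨fun a ha => Finset.mem_coe.2 (Finset.mem_erase.2
            ⟨fun h => hsK (h ▸ ha), hKS ha⟩), hK⟩
          exact ⟨some x, hx⟩
      · rintro ⟨_ | x, hx⟩
        · have hx' : K ⊆ insert s Q := hx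
          refine ⟨fun a ha => ?_, IsClique.subset hx' (hclique.insert fun a ha _ => ha.2)⟩
          rcases hx' ha with rfl | h
          · exact hs
          · exact h.1
        · obtain ⟨h1, h2⟩ := (hβ K).2 ⟨x, hx⟩
          exact ⟨fun a ha => Finset.mem_of_mem_erase (h1 ha), h2⟩

/-- A finite chordal graph has a representation on a finite tree with at least two vertices. -/
lemma IsChordal.exists_isTreeRepresentation [Finite V] (hG : IsChordal G) :
    ∃ (N : Type) (T : SimpleGraph N) (β : N → Set V), Finite N ∧ Nontrivial N ∧
      IsTreeRepresentation G T β := by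
  have := Fintype.ofFinite V
  obtain ⟨N, T, β, hfin, hnt, hT, hconn, hβ⟩ := hG.exists_tree_bags Finset.univ
  refine ⟨N, T, β, hfin, hnt, hT, fun a => ?_, fun a => hconn a (Finset.mem_univ a), ?_⟩
  · obtain ⟨⟨x, hx⟩⟩ := (hconn a (Finset.mem_univ a)).nonempty
    exact ⟨x, hx⟩
  · ext a b
    constructor
    · intro hab
      obtain ⟨x, hx⟩ := (hβ {a, b}).1 ⟨by simp, by simp [hab]⟩
      exact ⟨hab.ne, x, hx (by simp), hx (by simp)⟩
    · rintro ⟨hab, x, hxa, hxb⟩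
      exact ((hβ (β x)).2 ⟨x, subset_rfl⟩).2 hxa hxb hab

end Representation

/-! ### Equivalence of the properties for fixed `k`. -/

section Equivalences

variable {V : Type u} {G : SimpleGraph V} {k : ℕ}

lemma isInterOfChordal_iff_hasNonEdgeSeparatingFamily [Finite V] :
    IsInterOfChordal G k ↔ HasNonEdgeSeparatingFamily G k := by
  constructor
  · rintro ⟨H, hH, hG⟩
    choose N T β hfin _ hrep using fun i => (hH i).exists_isTreeRepresentation
    refine ⟨fun i => ⟨N i, hfin i, T i, β i, H i, hG ▸ iInf_le H i, hH i, hrep i⟩,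
      fun a b hab hnadj => ?_⟩
    rw [hG, iInf_adj] at hnadj
    push Not at hnadj
    by_contra! hcon
    exact hab (hnadj fun i => by_contra fun h => hcon i ⟨hab, h⟩)
  · rintro ⟨D, hD⟩
    refine ⟨fun i => (D i).completion, fun i => (D i).isChordal_completion,
      le_antisymm (le_iInf fun i => (D i).le_completion) fun a b hab => ?_⟩
    rw [iInf_adj] at hab
    by_contra hnadj
    obtain ⟨i, -, hi⟩ := hD a b hab.2 hnadj
    exact hi (hab.1 i)

lemma IsInterOfChordal.exists_treeProduct [Finite V] (h : IsInterOfChordal G k) :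
    ∃ (N : Fin k → Type) (T : ∀ i, SimpleGraph (N i)), (∀ i, Finite (N i)) ∧
      (∀ i, Nontrivial (N i)) ∧ (∀ i, (T i).IsTree) ∧
        IsInterGraphOfConvexSubgraphs G (cartesianProduct T) := by
  obtain ⟨H, hH, hG⟩ := h
  choose N T β hfin hnt hrep using fun i => (hH i).exists_isTreeRepresentation
  have hT := fun i => (hrep i).isTree
  refine ⟨N, T, hfin, hnt, hT,
    fun a => (⊤ : (cartesianProduct T).Subgraph).induce {x | ∀ i, x i ∈ support (β i) a},
    fun a => ?_, fun a => ?_, ?_⟩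
  · choose x hx using fun i => (hrep i).nonempty a
    exact ⟨x, hx⟩
  · exact isConvexSet_box (fun i => (hT i).connected) fun i =>
      isConvexSet_of_induce_connected (hT i) ((hrep i).connected a)
  · ext a b
    rw [hG, iInf_adj]
    constructor
    · rintro ⟨hadj, hab⟩
      have hadj' : ∀ i, ∃ x, x ∈ support (β i) a ∩ support (β i) b := fun i => by
        have h := hadj i
        rw [(hrep i).eq_intersectionGraph] at h
        exact h.2
      choose x hx using hadj'
      exact ⟨hab, x, fun i => (hx i).1, fun i => (hx i).2⟩
    · rintro ⟨hab, x, hxa, hxb⟩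
      refine ⟨fun i => ?_, hab⟩
      rw [(hrep i).eq_intersectionGraph]
      exact ⟨hab, x i, hxa i, hxb i⟩

lemma isInterOfChordal_iff_isInterGraphInTreeProduct [Finite V] :
    IsInterOfChordal G k ↔ IsInterGraphInTreeProduct G k := by
  constructor
  · intro h
    obtain ⟨N, T, hfin, -, hT, hG⟩ := h.exists_treeProduct
    exact ⟨N, T, hfin, hT, hG⟩
  · rintro ⟨N, T, hfin, hT, hG⟩
    exact isInterOfChordal_of_isMedianGraph (isMedianGraph_cartesianProduct hT)
      ⟨N, T, id, hfin, hT, fun _ _ => rfl⟩ hG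

lemma isInterOfChordal_iff_isInterGraphInMedianGraph [Finite V] :
    IsInterOfChordal G k ↔ IsInterGraphInMedianGraph G k := by
  constructor
  · intro h
    obtain ⟨N, T, hfin, hnt, hT, hG⟩ := h.exists_treeProduct
    exact ⟨_, cartesianProduct T, inferInstance, isMedianGraph_cartesianProduct hT,
      treeDimension_cartesianProduct hfin hT hnt, hG⟩
  · rintro ⟨W, M, -, hM, hk, hG⟩
    exact isInterOfChordal_of_isMedianGraph hM (embedsInTreeProduct_of_treeDimension_eq hk) hG

lemma isInterGraphInMedianGraph_iff_exists_isComplete :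
    IsInterGraphInMedianGraph G k ↔ ∃ D : TreeMedianDecomposition G k, D.IsComplete := by
  constructor
  · intro h
    obtain ⟨W, M, hfin, hM, hk, F, hne, hconv, hG⟩ := id h
    refine ⟨⟨W, hfin, M, fun x => {a | x ∈ (F a).verts}, G, le_rfl, h, hM, hk, hne, hconv, hG⟩,
      fun x a ha b hb hab => ?_⟩
    rw [hG]
    exact ⟨hab, x, ha, hb⟩
  · rintro ⟨D, hD⟩
    -- An edge of the completion lies in a common bag, which is a clique of `G`.
    have h : D.completion ≤ G := fun a b hab => by
      rw [D.isRepresentation.eq_intersectionGraph] at hab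
      obtain ⟨hne, x, hxa, hxb⟩ := hab
      exact hD x hxa hxb hne
    exact le_antisymm h D.le_completion ▸ D.hasProperty_completion

end Equivalences

/-- A finite infimum rules out `S = ∅`, whose infimum is `⊤`, and over a nonempty set it is
attained. -/
lemma sInf_image_natCast_eq_iff_isLeast {S : Set ℕ} {k : ℕ} :
    sInf ((fun n : ℕ => (n : ℕ∞)) '' S) = k ↔ IsLeast S k := by
  constructor
  · intro h
    have hne : S.Nonempty := by
      rw [Set.nonempty_iff_ne_empty]
      rintro rfl
      simp at h
    obtain ⟨m, hm, hmk⟩ := csInf_mem (hne.image fun n : ℕ => (n : ℕ∞))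
    have hmk' : (m : ℕ∞) = k := hmk.trans h
    obtain rfl := Nat.cast_inj.1 hmk'
    exact ⟨hm, fun n hn => Nat.cast_le.1 (h.symm.trans_le (sInf_le ⟨n, hn, rfl⟩))⟩
  · rintro ⟨hk, hmin⟩
    refine le_antisymm (sInf_le ⟨k, hk, rfl⟩) (le_sInf ?_)
    rintro _ ⟨n, hn, rfl⟩
    exact Nat.cast_le.2 (hmin hn)

end GraphChordality

theorem theorem1 {V : Type*} [Finite V] (G : SimpleGraph V) :
    (∀ k : ℕ, 0 < k →
      [ GraphChordality.chordality G = k,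
        IsLeast {n : ℕ | 0 < n ∧ GraphChordality.HasNonEdgeSeparatingFamily G n} k,
        IsLeast {n : ℕ | 0 < n ∧ GraphChordality.IsInterGraphInTreeProduct G n} k,
        IsLeast {n : ℕ | 0 < n ∧ GraphChordality.IsInterGraphInMedianGraph G n} k,
        GraphChordality.treeMedianDimension G = k ].TFAE) ∧
    GraphChordality.treeMedianDimension G = GraphChordality.chordality G := by
  have h2 : {n : ℕ | 0 < n ∧ GraphChordality.HasNonEdgeSeparatingFamily G n} =
      {n : ℕ | 0 < n ∧ GraphChordality.IsInterOfChordal G n} := by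
    simp only [GraphChordality.isInterOfChordal_iff_hasNonEdgeSeparatingFamily]
  have h3 : {n : ℕ | 0 < n ∧ GraphChordality.IsInterGraphInTreeProduct G n} =
      {n : ℕ | 0 < n ∧ GraphChordality.IsInterOfChordal G n} := by
    simp only [GraphChordality.isInterOfChordal_iff_isInterGraphInTreeProduct]
  have h4 : {n : ℕ | 0 < n ∧ GraphChordality.IsInterGraphInMedianGraph G n} =
      {n : ℕ | 0 < n ∧ GraphChordality.IsInterOfChordal G n} := by
    simp only [GraphChordality.isInterOfChordal_iff_isInterGraphInMedianGraph]
  have h5 : GraphChordality.treeMedianDimension G = GraphChordality.chordality G := by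
    simp only [GraphChordality.treeMedianDimension, GraphChordality.chordality,
      GraphChordality.isInterOfChordal_iff_isInterGraphInMedianGraph,
      GraphChordality.isInterGraphInMedianGraph_iff_exists_isComplete]
  refine ⟨fun k _ => ?_, h5⟩
  rw [h2, h3, h4, h5, GraphChordality.chordality,
    GraphChordality.sInf_image_natCast_eq_iff_isLeast]
  simp
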